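/- Let $m$ be a natural number and let $X_1,X_2,\dots$ be an i.i.d. source of binary words $\mathbf w_1,\dots,\mathbf w_{2^m}$ of length $m$ with probabilities $P_1\ge P_2\ge\dots\ge P_{2^m}$ and entropy $H=-\sum_i P_i\log_2P_i>0$. Let $\mathbf y_1,\dots,\mathbf y_{2^m}$ be the binary words of length $m$ listed by non-decreasing cost $c_1\le\dots\le c_{2^m}$, where the cost $c(\mathbf y)$ of a word is its number of $0$ symbols. The SLC direct shaping code with this output list keeps a list of all input words with frequency counts, initially in lexicographic order with all counts $0$. An input word in position $k$ of the list, with count $n$, is encoded as $\mathbf y_k$; its count then becomes $n+1$ and it is moved above all words with counts at most $n+1$. A shaping code of block length $q\ge1$ maps successive blocks of $q$ input words to finite strings over the alphabet $\{\mathbf y_1,\dots,\mathbf y_{2^m}\}$, where the map used for a block may depend on the preceding blocks and where, given the preceding blocks, the codewords of distinct blocks are not prefixes of each other. It has rate $1$ if the expected length (in symbols of that alphabet) of the encoding of the first $t$ blocks, divided by $tq$, tends to $1$ as $t\to\infty$. Its average cost is the limit, if it exists, as $t\to\infty$, of the expected total cost of the encoding of the first $t$ blocks divided by $tq$. Then the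 direct shaping code is optimal with respect to average cost among rate-$1$ shaping codes, i.e. it is a rate-$1$ shaping code, it has an average cost, and no rate-$1$ shaping code has a smaller average cost, if and only if there is a real $\mu\ge0$ such that $$P_i=\frac{2^{-\mu c_i}}{\sum_j2^{-\mu c_j}}\quad(1\le i\le 2^m)\qquad\text{and}\qquad -\sum_iP_i\log_2P_i=H .$$ -/

import Mathlib

open MeasureTheory ProbabilityTheory Filter Topology

/-! ### Words, dictionaries and direct shaping codes -/

/-- Binary words of length `m`; `true` is the bit 1 and `false` is the bit 0. -/
abbrev Word (m : ℕ) : Type := Fin m → Bool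

/-- The SLC wear cost of a codeword: its number of 0 symbols. -/
def slcCost {m : ℕ} (v : Word m) : ℝ := ((Finset.univ.filter fun j => v j = false).card : ℝ)

/-- All binary words of length `m`, in lexicographic order. -/
def lexWords : (m : ℕ) → List (Word m)
  | 0 => [Fin.elim0]
  | m + 1 => (lexWords m).map (fun v => (Fin.cons false v : Word (m + 1))) ++
      (lexWords m).map (fun v => (Fin.cons true v : Word (m + 1)))

/-- The dynamic list of a dictionary: input words with their frequency counts, most frequent
first. -/
abbrev Dictionary (m : ℕ) : Type := List (Word m × ℕ)

/-- At the start all counts are 0 and the words are ordered lexicographically. -/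
def Dictionary.init (m : ℕ) : Dictionary m := (lexWords m).map fun x => (x, 0)

/-- The position (counted from 0) of the word `x` in the list. -/
def Dictionary.pos {m : ℕ} (D : Dictionary m) (x : Word m) : ℕ :=
  D.findIdx fun p => decide (p.1 = x)

/-- The frequency count of the word `x`. -/
def Dictionary.count {m : ℕ} (D : Dictionary m) (x : Word m) : ℕ :=
  ((D.find? fun p => decide (p.1 = x)).map Prod.snd).getD 0

/-- The update after the input word `x`, of count `n`: its pair becomes `(x, n + 1)` and is moved
above all pairs with counts at most `n + 1`, the other pairs keeping their relative order. -/
def Dictionary.update {m : ℕ} (D : Dictionary m) (x : Word m) : Dictionary m :=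
  let n := D.count x
  let rest := D.filter fun p => decide (p.1 ≠ x)
  rest.filter (fun p => decide (n + 1 < p.2)) ++
    (x, n + 1) :: rest.filter (fun p => decide (p.2 ≤ n + 1))

/-! ### Shaping codes

A shaping encoder maps successive input blocks in `α ^ q` to strings over the output alphabet `β`.
The string chosen for a block may depend on the blocks encoded before (oldest first); a map
`α ^ q → β*` is the case in which it does not. -/

/-- Shaping encoders with block length `q`: the arguments are the list of past blocks and the
current block. -/
abbrev ShapingEncoder (q : ℕ) (α β : Type) : Type :=
  List (Fin q → α) → (Fin q → α) → List β

/-- Given the past, distinct blocks have codewords neither of which is a prefix of the other, so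
that a decoder that knows the past blocks can recover the current one. -/
def ShapingEncoder.PrefixFree {q : ℕ} {α β : Type} (φ : ShapingEncoder q α β) : Prop :=
  ∀ (h : List (Fin q → α)) (b b' : Fin q → α), φ h b <+: φ h b' → b = b'

/-- The `k`-th block of `q` symbols of a sequence. -/
def block {α : Type} (q : ℕ) (x : ℕ → α) (k : ℕ) : Fin q → α := fun j => x (k * q + j)

/-- The output of the encoder on the first `t` blocks of the sequence `x`. -/
def ShapingEncoder.output {q : ℕ} {α β : Type} (φ : ShapingEncoder q α β) (x : ℕ → α) (t : ℕ) :
    List β :=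
  (List.range t).flatMap fun k => φ ((List.range k).map (block q x)) (block q x k)

/-- The expansion factor of the encoder on the source `X` is `f`: the ratio of the expected output
length to the input length tends to `f`. (For a fixed map `α ^ q → β*` and an i.i.d. source this
ratio does not depend on `t ≥ 1`.) -/
def ShapingEncoder.HasExpansionFactor {Ω : Type*} [MeasurableSpace Ω] (ν : Measure Ω)
    {q : ℕ} {α β : Type} (X : ℕ → Ω → α) (φ : ShapingEncoder q α β) (f : ℝ) : Prop :=
  Tendsto (fun t : ℕ =>
    ∫ ω, ((φ.output (fun n => X n ω) t).length : ℝ) / ((t : ℝ) * (q : ℝ)) ∂ν) atTop (𝓝 f)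

/-- The asymptotic expected average cost of the encoder on the source `X` is `C`: the expected cost
of the output (costs of strings are additive) per source symbol tends to `C`. -/
def ShapingEncoder.HasAverageCost {Ω : Type*} [MeasurableSpace Ω] (ν : Measure Ω)
    {q : ℕ} {α β : Type} (X : ℕ → Ω → α) (cost : β → ℝ) (φ : ShapingEncoder q α β) (C : ℝ) :
    Prop :=
  Tendsto (fun t : ℕ =>
    ∫ ω, ((φ.output (fun n => X n ω) t).map cost).sum / ((t : ℝ) * (q : ℝ)) ∂ν) atTop (𝓝 C)

/-- Rate-1 shaping codes for the source `X`: positive block length, prefix-free, and expansion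
factor 1. -/
def ShapingEncoder.IsRateOne {Ω : Type*} [MeasurableSpace Ω] (ν : Measure Ω)
    {q : ℕ} {α β : Type} (X : ℕ → Ω → α) (φ : ShapingEncoder q α β) : Prop :=
  0 < q ∧ φ.PrefixFree ∧ φ.HasExpansionFactor ν X 1

/-- `φ` is a rate-1 shaping code for the source `X` that has an asymptotic expected average cost,
and no rate-1 shaping code, of whatever block length, has a smaller one. -/
def ShapingEncoder.IsOptimalRateOne {Ω : Type*} [MeasurableSpace Ω] (ν : Measure Ω)
    {q : ℕ} {α β : Type} (X : ℕ → Ω → α) (cost : β → ℝ) (φ : ShapingEncoder q α β) : Prop :=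
  φ.IsRateOne ν X ∧ ∃ C : ℝ, φ.HasAverageCost ν X cost C ∧
    ∀ (q' : ℕ) (ψ : ShapingEncoder q' α β) (C' : ℝ),
      ψ.IsRateOne ν X → ψ.HasAverageCost ν X cost C' → C ≤ C'

/-- The SLC direct shaping code with output list `y`: the input word is mapped to the codeword at
the same position of the output list, and the dictionary is then updated. (The dictionary always
lists every word exactly once, so the position is in range and one codeword is put out.) -/
def directShapingCode {m : ℕ} (y : Fin (2 ^ m) → Word m) :
    ShapingEncoder 1 (Word m) (Word m) := fun h b =>
  let D : Dictionary m := h.foldl (fun D b' => D.update (b' 0)) (Dictionary.init m)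
  ((List.ofFn y)[D.pos (b 0)]?).toList

/-- Entropy in bits, with `0 log 0 = 0`. -/
noncomputable def entropyBits {ι : Type} [Fintype ι] (p : ι → ℝ) : ℝ :=
  -∑ i, p i * Real.logb 2 (p i)

/-!
Give the output symbols the weights `exp (-s c) / Z(s)`, where `Z(s) = ∑ exp (-s c)`. By Kraft's
inequality and Gibbs' inequality, the entropy of the source is at most `s C + log Z(s)` for every
rate-1 code of average cost `C` and every real `s`. If the source has the Gibbs distribution of
parameter `r > 0`, the choice `s = r` shows that `C` is at least `∑ P i * c i`, the cost of encoding
the `i`-th most probable word by the `i`-th cheapest one. If `r = 0`, the bound is an equality at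
`s = 0`, and differentiating it there gives the same conclusion. By the strong law of large numbers
the dictionary eventually orders the words by probability, so the direct shaping code attains
`∑ P i * c i`.

Conversely, if this cost is optimal, then it cannot be lowered by exchanging the codewords of two
blocks of `q` words, so on blocks of every length higher probability means no higher cost. Comparing
blocks in which one word is repeated `A` times with blocks in which another one is repeated `B`
times, for all ratios `A / B`, makes `-log P i` an affine function of `c i`, which is the Gibbs
form.
-/

/-! ### Kraft's inequality, entropy and Gibbs distributions -/

lemma prod_map_eq_mul_prod_map_tail {β M : Type*} [Monoid M] {l : List β} {a : β}
    (h : l.head? = some a) (Q : β → M) : (l.map Q).prod = Q a * (l.tail.map Q).prod := by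
  rw [← List.prod_cons, ← List.map_cons, List.cons_head?_tail h]

lemma sum_prod_map_le_one_of_prefixFree {ι β R : Type*} [Fintype β] [CommSemiring R]
    [PartialOrder R] [IsOrderedRing R] {Q : β → R} (hQ : ∀ a, 0 ≤ Q a) (hQ_sum : ∑ a, Q a ≤ 1)
    (s : Finset ι) (f : ι → List β) (hf : ∀ i ∈ s, ∀ j ∈ s, f i <+: f j → i = j) :
    ∑ i ∈ s, ((f i).map Q).prod ≤ 1 := by
  classical
  obtain ⟨L, hL⟩ : ∃ L, ∀ i ∈ s, (f i).length ≤ L :=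
    ⟨s.sup fun i => (f i).length, fun i hi => Finset.le_sup (f := fun i => (f i).length) hi⟩
  induction L generalizing s f with
  | zero =>
    have hnil : ∀ i ∈ s, f i = [] := fun i hi => List.length_eq_zero_iff.1 (Nat.le_zero.1 (hL i hi))
    obtain rfl | ⟨i, hi⟩ := s.eq_empty_or_nonempty
    · simp
    · obtain rfl : s = {i} := Finset.eq_singleton_iff_unique_mem.2
        ⟨hi, fun j hj => hf j hj i hi (by simp [hnil j hj])⟩
      simp [hnil]
  | succ L ih =>
    by_cases h : ∃ i ∈ s, f i = []
    · obtain ⟨i, hi, hi_nil⟩ := h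
      obtain rfl : s = {i} := Finset.eq_singleton_iff_unique_mem.2
        ⟨hi, fun j hj => (hf i hi j hj (by simp [hi_nil])).symm⟩
      simp [hi_nil]
    · have hfiber_none : (s.filter fun i => (f i).head? = none) = ∅ :=
        Finset.filter_eq_empty_iff.2 fun i hi hhead => h ⟨i, hi, List.head?_eq_none_iff.1 hhead⟩
      rw [← Finset.sum_fiberwise s (fun i => (f i).head?), Fintype.sum_option, hfiber_none,
        Finset.sum_empty, zero_add]
      refine (Finset.sum_le_sum fun a _ => ?_).trans hQ_sum
      set t := s.filter fun i => (f i).head? = some a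
      have hhead : ∀ i ∈ t, (f i).head? = some a := fun i hi => (Finset.mem_filter.1 hi).2
      have hts : ∀ i ∈ t, i ∈ s := fun i hi => (Finset.mem_filter.1 hi).1
      rw [Finset.sum_congr rfl fun i hi => prod_map_eq_mul_prod_map_tail (hhead i hi) Q,
        ← Finset.mul_sum]
      refine mul_le_of_le_one_right (hQ a) (ih t _ (fun i hi j hj hij => ?_) fun i hi => ?_)
      · refine hf i (hts i hi) j (hts j hj) ?_
        rw [← List.cons_head?_tail (hhead i hi), ← List.cons_head?_tail (hhead j hj)]
        exact (List.prefix_cons_inj a).2 hij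
      · simpa using hL i (hts i hi)

lemma sum_negMulLog_le_sum_mul {ι : Type*} {s : Finset ι} {p ℓ : ι → ℝ} (hp : ∀ i ∈ s, 0 ≤ p i)
    (hℓ : ∑ i ∈ s, Real.exp (-ℓ i) ≤ ∑ i ∈ s, p i) :
    ∑ i ∈ s, Real.negMulLog (p i) ≤ ∑ i ∈ s, p i * ℓ i := by
  have hterm : ∀ i ∈ s, Real.negMulLog (p i) ≤ p i * ℓ i + (Real.exp (-ℓ i) - p i) := by
    intro i hi
    obtain hi | hi := (hp i hi).eq_or_lt
    · simp [← hi, Real.exp_nonneg]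
    · have h := mul_le_mul_of_nonneg_left (Real.add_one_le_exp (-ℓ i - Real.log (p i))) hi.le
      rw [Real.exp_sub, Real.exp_log hi, mul_div_cancel₀ _ hi.ne'] at h
      rw [Real.negMulLog]
      linarith
  have hsum := Finset.sum_le_sum hterm
  rw [Finset.sum_add_distrib, Finset.sum_sub_distrib] at hsum
  linarith

lemma sum_prod_mul_sum {ι α R : Type*} [Fintype ι] [DecidableEq ι] [Fintype α] [CommSemiring R]
    {p : α → R} (hp : ∑ x, p x = 1) (f : α → R) :
    ∑ b : ι → α, (∏ i, p (b i)) * ∑ i, f (b i) = Fintype.card ι * ∑ x, p x * f x := by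
  have hcoord (j : ι) : ∑ b : ι → α, (∏ i, p (b i)) * f (b j) = ∑ x, p x * f x := by
    calc ∑ b : ι → α, (∏ i, p (b i)) * f (b j)
        = ∑ b : ι → α, ∏ i, p (b i) * if i = j then f (b i) else 1 := by
          simp [Finset.prod_mul_distrib, -mul_ite]
      _ = ∏ i, ∑ x, p x * if i = j then f x else 1 :=
          (Fintype.prod_sum fun i x => p x * if i = j then f x else 1).symm
      _ = ∏ i, if i = j then ∑ x, p x * f x else 1 := by
          refine Finset.prod_congr rfl fun i _ => ?_
          split_ifs <;> simp [hp]
      _ = ∑ x, p x * f x := by simp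
  simp only [Finset.mul_sum]
  rw [Finset.sum_comm]
  simp only [hcoord, Finset.sum_const, Finset.card_univ, nsmul_eq_mul, Finset.mul_sum]

lemma negMulLog_prod {ι : Type*} (s : Finset ι) (p : ι → ℝ) :
    Real.negMulLog (∏ i ∈ s, p i) = (∏ i ∈ s, p i) * ∑ i ∈ s, -Real.log (p i) := by
  obtain h | h := eq_or_ne (∏ i ∈ s, p i) 0
  · simp [h]
  · rw [Real.negMulLog, Real.log_prod fun i hi => Finset.prod_ne_zero_iff.1 h i hi,
      Finset.sum_neg_distrib, neg_mul_comm]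

lemma sum_negMulLog_prod {ι α : Type*} [Fintype ι] [DecidableEq ι] [Fintype α] {p : α → ℝ}
    (hp : ∑ x, p x = 1) :
    ∑ b : ι → α, Real.negMulLog (∏ i, p (b i)) = Fintype.card ι * ∑ x, Real.negMulLog (p x) := by
  simp only [negMulLog_prod]
  refine (sum_prod_mul_sum hp fun x => -Real.log (p x)).trans ?_
  simp only [Real.negMulLog, neg_mul_comm]

section Gibbs

variable {ι κ : Type*} [Fintype ι] [Fintype κ]

/-- The partition function of the costs `c` at inverse temperature `s`, to base `e`. -/
noncomputable def partitionFunction (c : ι → ℝ) (s : ℝ) : ℝ := ∑ i, Real.exp (-(s * c i))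

/-- The Gibbs distribution of the costs `c` at inverse temperature `s`, to base `e`; the base-2
parameter `μ` of the theorem corresponds to `s = μ log 2`. -/
noncomputable def gibbsProb (c : ι → ℝ) (s : ℝ) (i : ι) : ℝ :=
  Real.exp (-(s * c i)) / partitionFunction c s

lemma two_rpow_div_sum_eq_gibbsProb (c : ι → ℝ) (μ : ℝ) (i : ι) :
    (2 : ℝ) ^ (-μ * c i) / ∑ j, (2 : ℝ) ^ (-μ * c j) = gibbsProb c (Real.log 2 * μ) i := by
  simp only [gibbsProb, partitionFunction, Real.rpow_def_of_pos two_pos, neg_mul, mul_neg,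
    mul_assoc]

lemma partitionFunction_pos [Nonempty ι] (c : ι → ℝ) (s : ℝ) : 0 < partitionFunction c s :=
  Finset.sum_pos (fun _ _ => Real.exp_pos _) Finset.univ_nonempty

lemma partitionFunction_comp_equiv (e : ι ≃ κ) (c : κ → ℝ) :
    partitionFunction (c ∘ e) = partitionFunction c := by
  funext s
  exact e.sum_comp fun k => Real.exp (-(s * c k))

lemma gibbsProb_comp_equiv (e : ι ≃ κ) (c : κ → ℝ) (s : ℝ) (i : ι) :
    gibbsProb (c ∘ e) s i = gibbsProb c s (e i) := by
  rw [gibbsProb, partitionFunction_comp_equiv, gibbsProb, Function.comp_apply]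

lemma sum_gibbsProb [Nonempty ι] (c : ι → ℝ) (s : ℝ) : ∑ i, gibbsProb c s i = 1 := by
  simp only [gibbsProb]
  rw [← Finset.sum_div]
  exact div_self (partitionFunction_pos c s).ne'

lemma eq_gibbsProb_of_eq_mul_exp {p c : ι → ℝ} {K s : ℝ} (hp : ∑ i, p i = 1)
    (h : ∀ i, p i = K * Real.exp (-(s * c i))) (i : ι) : p i = gibbsProb c s i := by
  have hK : K * partitionFunction c s = 1 := by
    rw [partitionFunction, Finset.mul_sum, ← hp]
    exact Finset.sum_congr rfl fun j _ => (h j).symm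
  rw [gibbsProb, eq_div_iff (right_ne_zero_of_mul_eq_one hK), h i]
  linear_combination Real.exp (-(s * c i)) * hK

lemma sum_negMulLog_gibbsProb [Nonempty ι] (c : ι → ℝ) (s : ℝ) :
    ∑ i, Real.negMulLog (gibbsProb c s i) =
      s * ∑ i, gibbsProb c s i * c i + Real.log (partitionFunction c s) := by
  have hlog (i : ι) : -Real.log (gibbsProb c s i) = s * c i + Real.log (partitionFunction c s) := by
    rw [gibbsProb, Real.log_div (Real.exp_pos _).ne' (partitionFunction_pos c s).ne', Real.log_exp]
    ring
  simp only [Real.negMulLog, neg_mul_comm, hlog, mul_add, Finset.sum_add_distrib]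
  rw [← Finset.sum_mul, sum_gibbsProb, one_mul, Finset.mul_sum]
  simp only [mul_left_comm]

lemma hasDerivAt_log_partitionFunction [Nonempty ι] (c : ι → ℝ) (s : ℝ) :
    HasDerivAt (fun s => Real.log (partitionFunction c s)) (-∑ i, gibbsProb c s i * c i) s := by
  have hterm (i : ι) : HasDerivAt (fun s => Real.exp (-(s * c i)))
      (Real.exp (-(s * c i)) * -(1 * c i)) s :=
    ((hasDerivAt_id' s).mul_const (c i)).neg.exp
  have hZ : HasDerivAt (partitionFunction c) (∑ i, Real.exp (-(s * c i)) * -(1 * c i)) s :=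
    HasDerivAt.fun_sum fun i _ => hterm i
  convert hZ.log (partitionFunction_pos c s).ne' using 1
  simp only [gibbsProb, div_mul_eq_mul_div, one_mul, mul_neg, Finset.sum_neg_distrib,
    ← Finset.sum_div, neg_div]

lemma sum_gibbsProb_mul_le_of_forall_entropy_le [Nonempty ι] (c : ι → ℝ) {r C : ℝ} (hr : 0 ≤ r)
    (hC : ∀ s, ∑ i, Real.negMulLog (gibbsProb c r i) ≤ s * C + Real.log (partitionFunction c s)) :
    ∑ i, gibbsProb c r i * c i ≤ C := by
  rw [sum_negMulLog_gibbsProb] at hC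
  obtain rfl | hr := hr.eq_or_lt
  · -- The bound at `s = r` says nothing for `r = 0`, but there it is attained, so its derivative
    -- vanishes.
    have hmin : IsLocalMin (fun s => s * C + Real.log (partitionFunction c s)) 0 :=
      Eventually.of_forall fun s => by simpa using hC s
    have hderiv := hmin.hasDerivAt_eq_zero
      (((hasDerivAt_id' (0 : ℝ)).mul_const C).add (hasDerivAt_log_partitionFunction c 0))
    linarith
  · exact le_of_mul_le_mul_left (by linarith [hC r]) hr

end Gibbs

/-! ### Probabilities ordered like the costs on all blocks -/

section CostOrdered

variable {ι : Type*}

/-- On blocks of every length, a more probable block does not cost more than a less probable one,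
for letters with probabilities `p` and costs `c`. A code that encodes letter by letter satisfies
this if it cannot be improved by exchanging the codewords of two blocks. -/
def IsCostOrdered (p c : ι → ℝ) : Prop :=
  ∀ (q : ℕ) (I J : Fin q → ι), ∏ j, p (J j) < ∏ j, p (I j) → ∑ j, c (I j) ≤ ∑ j, c (J j)

lemma exists_nat_mul_lt_mul_and_mul_lt_mul {x y u v : ℝ} (hx : 0 ≤ x) (hy : 0 ≤ y) (hv : 0 ≤ v)
    (h : x * v < u * y) : ∃ A B : ℕ, A * x < B * y ∧ B * v < A * u := by
  have hy : 0 < y := hy.lt_of_ne (by rintro rfl; nlinarith)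
  obtain ⟨A, hA⟩ := exists_nat_gt (y * v / (u * y - x * v))
  rw [div_lt_iff₀ (sub_pos.2 h)] at hA
  have hfloor := Nat.floor_le (show 0 ≤ A * x / y by positivity)
  have hlt := Nat.lt_floor_add_one (A * x / y)
  rw [le_div_iff₀ hy] at hfloor
  rw [div_lt_iff₀ hy] at hlt
  refine ⟨A, ⌊A * x / y⌋₊ + 1, by exact_mod_cast hlt, ?_⟩
  refine lt_of_mul_lt_mul_right ?_ hy.le
  push_cast
  nlinarith [mul_le_mul_of_nonneg_right hfloor hv]

namespace IsCostOrdered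

variable {p c : ι → ℝ} {z : ι}

lemma mul_sub_le_mul_sub (h : IsCostOrdered p c) {A B : ℕ} {i l : ι}
    (hp : p z ^ A * p l ^ B < p i ^ A * p z ^ B) : A * (c i - c z) ≤ B * (c l - c z) := by
  have hblock := h (A + B) (Fin.append (fun _ : Fin A => i) fun _ : Fin B => z)
    (Fin.append (fun _ : Fin A => z) fun _ : Fin B => l) (by simpa [Fin.prod_univ_add] using hp)
  simp only [Fin.sum_univ_add, Fin.append_left, Fin.append_right, Finset.sum_const,
    Finset.card_univ, Fintype.card_fin, nsmul_eq_mul] at hblock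
  linarith

lemma le_of_forall_ne_lt (h : IsCostOrdered p c) (hz : ∀ i ≠ z, c z < c i) (i : ι) :
    p i ≤ p z := by
  obtain rfl | hi := eq_or_ne i z
  · exact le_rfl
  · by_contra! hlt
    have := h.mul_sub_le_mul_sub (A := 1) (B := 0) (i := i) (l := i) (by simpa using hlt)
    norm_num at this
    linarith [hz i hi]

lemma pos_of_forall_ne_lt (h : IsCostOrdered p c) (hz : ∀ i ≠ z, c z < c i) (hp : ∀ i, 0 ≤ p i)
    {i₁ : ι} (hi₁ : i₁ ≠ z) (hpi₁ : p i₁ ≠ 0) (j : ι) : 0 < p j := by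
  refine (hp j).lt_of_ne fun hj => ?_
  have hpos : 0 < p i₁ := (hp i₁).lt_of_ne' hpi₁
  have hpz : 0 < p z := hpos.trans_le (h.le_of_forall_ne_lt hz i₁)
  obtain ⟨n, hn⟩ := exists_nat_gt ((c j - c z) / (c i₁ - c z))
  rw [div_lt_iff₀ (sub_pos.2 (hz i₁ hi₁))] at hn
  have := h.mul_sub_le_mul_sub (A := n) (B := 1) (i := i₁) (l := j) (z := z)
    (by rw [← hj, pow_one, mul_zero]; positivity)
  push_cast at this
  linarith

/-- With the same inequality for `l` and `i` exchanged, the excess cost of a letter is proportional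
to the logarithm of the ratio of probabilities. -/
lemma sub_mul_log_div_le (h : IsCostOrdered p c) (hz : ∀ i ≠ z, c z < c i) (hp : ∀ i, 0 < p i)
    (i l : ι) :
    (c i - c z) * Real.log (p z / p l) ≤ (c l - c z) * Real.log (p z / p i) := by
  have hlog (i : ι) : 0 ≤ Real.log (p z / p i) :=
    Real.log_nonneg ((one_le_div (hp i)).2 (h.le_of_forall_ne_lt hz i))
  have hcz : 0 ≤ c l - c z := by
    obtain rfl | hl := eq_or_ne l z
    · simp
    · exact (sub_pos.2 (hz l hl)).le
  by_contra! hlt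
  obtain ⟨A, B, hAB, hcost⟩ := exists_nat_mul_lt_mul_and_mul_lt_mul (hlog i) (hlog l) hcz
    (by rwa [mul_comm])
  refine hcost.not_ge (h.mul_sub_le_mul_sub ?_)
  rw [← Real.log_pow, ← Real.log_pow, Real.log_lt_log_iff (pow_pos (div_pos (hp z) (hp i)) A)
    (pow_pos (div_pos (hp z) (hp l)) B), div_pow, div_pow,
    div_lt_div_iff₀ (pow_pos (hp i) A) (pow_pos (hp l) B)] at hAB
  linarith

lemma exists_eq_gibbsProb [Fintype ι] (h : IsCostOrdered p c) (hz : ∀ i ≠ z, c z < c i)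
    (hp : ∀ i, 0 ≤ p i) (hp_sum : ∑ i, p i = 1) {i₁ : ι} (hi₁ : i₁ ≠ z) (hpi₁ : p i₁ ≠ 0) :
    ∃ r, 0 ≤ r ∧ ∀ i, p i = gibbsProb c r i := by
  have hpos := h.pos_of_forall_ne_lt hz hp hi₁ hpi₁
  have hc₁ : 0 < c i₁ - c z := sub_pos.2 (hz i₁ hi₁)
  set r := Real.log (p z / p i₁) / (c i₁ - c z) with hr
  have hlog (i : ι) : Real.log (p z / p i) = r * (c i - c z) := by
    rw [hr, div_mul_eq_mul_div, eq_div_iff hc₁.ne']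
    linarith [h.sub_mul_log_div_le hz hpos i i₁, h.sub_mul_log_div_le hz hpos i₁ i]
  refine ⟨r, div_nonneg ?_ hc₁.le,
    eq_gibbsProb_of_eq_mul_exp (K := p z * Real.exp (r * c z)) hp_sum fun i => ?_⟩
  · exact Real.log_nonneg ((one_le_div (hpos i₁)).2 (h.le_of_forall_ne_lt hz i₁))
  · rw [mul_assoc, ← Real.exp_add, show r * c z + -(r * c i) = -Real.log (p z / p i) by
      rw [hlog]; ring, Real.exp_neg, Real.exp_log (div_pos (hpos z) (hpos i)), inv_div,
      mul_div_cancel₀ _ (hpos z).ne']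

end IsCostOrdered

end CostOrdered

lemma exists_ne_of_entropyBits_ne_zero {ι : Type} [Fintype ι] {p : ι → ℝ} (hp : ∑ i, p i = 1)
    (hH : entropyBits p ≠ 0) (z : ι) : ∃ i ≠ z, p i ≠ 0 := by
  by_contra! hzero
  have hpz : p z = 1 := by rwa [Fintype.sum_eq_single z hzero] at hp
  refine hH ?_
  rw [entropyBits, Fintype.sum_eq_single z fun i hi => by rw [hzero i hi, zero_mul], hpz]
  simp

/-! ### The dictionary of the direct shaping code -/

lemma nodup_lexWords (m : ℕ) : (lexWords m).Nodup := by
  induction m with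
  | zero => simp [lexWords]
  | succ m ih =>
    have hmap (b : Bool) : ((lexWords m).map fun v => (Fin.cons b v : Word (m + 1))).Nodup :=
      ih.map (Fin.cons_right_injective (α := fun _ => Bool) b)
    refine (hmap false).append (hmap true) fun v hv hv' => ?_
    obtain ⟨a, -, rfl⟩ := List.mem_map.1 hv
    obtain ⟨b, -, h⟩ := List.mem_map.1 hv'
    simpa using congrFun h 0

lemma mem_lexWords {m : ℕ} (v : Word m) : v ∈ lexWords m := by
  induction m with
  | zero => simp [lexWords, Subsingleton.elim v Fin.elim0]
  | succ m ih =>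
    rw [lexWords, List.mem_append, List.mem_map, List.mem_map]
    cases h : v 0
    · exact Or.inl ⟨Fin.tail v, ih _, by rw [← h]; exact Fin.cons_self_tail v⟩
    · exact Or.inr ⟨Fin.tail v, ih _, by rw [← h]; exact Fin.cons_self_tail v⟩

/-- The dictionary lists every word `x` exactly once, with the count `n x`, and the counts are
non-increasing along the list. -/
structure Dictionary.Represents {m : ℕ} (D : Dictionary m) (n : Word m → ℕ) : Prop where
  nodup : (D.map Prod.fst).Nodup
  mem : ∀ x, (x, n x) ∈ D
  sorted : D.Pairwise fun a b => b.2 ≤ a.2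

namespace Dictionary.Represents

variable {m : ℕ} {D : Dictionary m} {n : Word m → ℕ}

lemma init : (Dictionary.init m).Represents fun _ => 0 where
  nodup := by simpa [Dictionary.init, Function.comp_def] using nodup_lexWords m
  mem x := by simpa [Dictionary.init] using mem_lexWords x
  sorted := by
    rw [Dictionary.init, List.pairwise_map]
    exact List.pairwise_of_forall fun _ _ => le_rfl

lemma snd_eq_of_mem (h : D.Represents n) {a : Word m × ℕ} (ha : a ∈ D) : a.2 = n a.1 :=
  congrArg Prod.snd (List.inj_on_of_nodup_map h.nodup ha (h.mem a.1) rfl)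

lemma count_eq (h : D.Represents n) (x : Word m) : D.count x = n x := by
  unfold Dictionary.count
  cases hfind : D.find? fun p => decide (p.1 = x) with
  | none => simpa using List.find?_eq_none.1 hfind _ (h.mem x)
  | some a =>
    have hax : a.1 = x := by simpa using List.find?_some hfind
    simp [h.snd_eq_of_mem (List.mem_of_find?_eq_some hfind), hax]

lemma update_perm (h : D.Represents n) (x : Word m) :
    (D.update x).Perm ((x, n x + 1) :: D.filter fun p => decide (p.1 ≠ x)) := by
  simp only [Dictionary.update, h.count_eq]
  refine List.perm_middle.trans (List.Perm.cons _ ?_)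
  simpa only [← decide_not, not_lt] using
    List.filter_append_perm (fun p : Word m × ℕ => decide (n x + 1 < p.2))
      (D.filter fun p => decide (p.1 ≠ x))

lemma pairwise_update (h : D.Represents n) (x : Word m) :
    (D.update x).Pairwise fun a b => b.2 ≤ a.2 := by
  simp only [Dictionary.update, h.count_eq]
  have hrest (r : Word m × ℕ → Bool) :
      ((D.filter fun p => decide (p.1 ≠ x)).filter r).Pairwise fun a b => b.2 ≤ a.2 :=
    h.sorted.sublist (List.filter_sublist.trans List.filter_sublist)
  have hlow : ∀ a ∈ (D.filter fun p => decide (p.1 ≠ x)).filter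
      (fun p => decide (p.2 ≤ n x + 1)), a.2 ≤ n x + 1 :=
    fun a ha => of_decide_eq_true (List.mem_filter.1 ha).2
  refine List.pairwise_append.2 ⟨hrest _, List.pairwise_cons.2 ⟨hlow, hrest _⟩, fun a ha b hb => ?_⟩
  have hhigh : n x + 1 < a.2 := of_decide_eq_true (List.mem_filter.1 ha).2
  obtain rfl | hb := List.mem_cons.1 hb
  · exact hhigh.le
  · exact (hlow b hb).trans hhigh.le

lemma update (h : D.Represents n) (x : Word m) :
    (D.update x).Represents (Function.update n x (n x + 1)) where
  nodup := by
    rw [((h.update_perm x).map Prod.fst).nodup_iff, List.map_cons, List.nodup_cons]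
    exact ⟨by simp, h.nodup.sublist (List.filter_sublist.map _)⟩
  mem z := by
    rw [(h.update_perm x).mem_iff]
    obtain rfl | hz := eq_or_ne z x
    · simp
    · simp [hz, h.mem z]
  sorted := h.pairwise_update x

lemma foldl_update (h : D.Represents n) (l : List (Word m)) :
    (l.foldl Dictionary.update D).Represents fun x => n x + l.count x := by
  induction l generalizing D n with
  | nil => simpa using h
  | cons a l ih =>
    rw [List.foldl_cons]
    convert ih (h.update a) using 2 with x
    obtain rfl | hx := eq_or_ne x a
    · rw [List.count_cons_self, Function.update_self]; ring
    · rw [List.count_cons_of_ne hx.symm, Function.update_of_ne hx]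

lemma length_eq (h : D.Represents n) : D.length = 2 ^ m := by
  have huniv : (D.map Prod.fst).toFinset = Finset.univ := Finset.eq_univ_of_forall fun x =>
    List.mem_toFinset.2 (List.mem_map.2 ⟨_, h.mem x, rfl⟩)
  have hcard := List.toFinset_card_of_nodup h.nodup
  rw [huniv] at hcard
  simpa using hcard.symm

lemma pos_eq (h : D.Represents n) {k : ℕ} (hk : k < D.length) : D.pos D[k].1 = k := by
  rw [Dictionary.pos, List.findIdx_eq hk]
  refine ⟨by simp, fun j hj => decide_eq_false fun hjk => hj.ne ?_⟩
  refine (h.nodup.getElem_inj_iff (hi := by simpa using hj.trans hk) (hj := by simpa using hk)).1 ?_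
  simpa using hjk

lemma exists_equiv (h : D.Represents n) :
    ∃ d : Fin (2 ^ m) ≃ Word m, (∀ k, D.pos (d k) = k) ∧ Antitone (n ∘ d) := by
  have hlt (k : Fin (2 ^ m)) : (k : ℕ) < D.length := k.2.trans_eq h.length_eq.symm
  let d : Fin (2 ^ m) → Word m := fun k => (D[(k : ℕ)]'(hlt k)).1
  have hpos (k : Fin (2 ^ m)) : D.pos (d k) = k := h.pos_eq (hlt k)
  have hinj : Function.Injective d := fun i j hij =>
    Fin.ext ((hpos i).symm.trans ((congrArg D.pos hij).trans (hpos j)))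
  have hbij : Function.Bijective d := (Fintype.bijective_iff_injective_and_card d).2 ⟨hinj, by simp⟩
  refine ⟨Equiv.ofBijective d hbij, hpos, fun i j hij => ?_⟩
  obtain rfl | hij := hij.eq_or_lt
  · exact le_rfl
  · have hsnd := List.pairwise_iff_getElem.1 h.sorted i j (hlt i) (hlt j) hij
    rwa [h.snd_eq_of_mem (List.getElem_mem _), h.snd_eq_of_mem (List.getElem_mem _)] at hsnd

end Dictionary.Represents

/-- The number of occurrences of the word `x` in the history `h` of the direct shaping code. -/
def wordCount {m : ℕ} (h : List (Fin 1 → Word m)) (x : Word m) : ℕ := (h.map (· 0)).count x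

lemma exists_directShapingCode_eq {m : ℕ} (y : Fin (2 ^ m) → Word m) (h : List (Fin 1 → Word m)) :
    ∃ d : Fin (2 ^ m) ≃ Word m, Antitone (wordCount h ∘ d) ∧
      ∀ b, directShapingCode y h b = [y (d.symm (b 0))] := by
  obtain ⟨d, hpos, hanti⟩ :=
    ((Dictionary.Represents.init (m := m)).foldl_update (h.map (· 0))).exists_equiv
  refine ⟨d, fun i j hij => by simpa using! hanti hij, fun b => ?_⟩
  have hb := hpos (d.symm (b 0))
  rw [Equiv.apply_symm_apply, List.foldl_map] at hb
  simp [directShapingCode, hb]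

lemma directShapingCode_prefixFree {m : ℕ} {y : Fin (2 ^ m) → Word m} (hy : Function.Injective y) :
    (directShapingCode y).PrefixFree := by
  intro h b b' hbb
  obtain ⟨d, -, hd⟩ := exists_directShapingCode_eq y h
  rw [hd, hd] at hbb
  have hword := d.symm.injective (hy (List.singleton_inj.1 (hbb.eq_of_length rfl)))
  funext j
  rwa [Subsingleton.elim j 0]

/-! ### Expected costs of shaping codes on an i.i.d. source -/

lemma integrable_comp_of_finite {Ω α : Type*} [MeasurableSpace Ω] {ν : Measure Ω}
    [IsFiniteMeasure ν] [Finite α] [MeasurableSpace α] [MeasurableSingletonClass α] {A : Ω → α}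
    (hA : Measurable A) (f : α → ℝ) : Integrable (fun ω => f (A ω)) ν :=
  (Integrable.of_finite (μ := ν.map A) (f := f)).comp_measurable hA

lemma integral_comp_eq_integral_sum_of_indepFun {Ω α β : Type*} [MeasurableSpace Ω]
    {ν : Measure Ω} [IsFiniteMeasure ν] [Finite α] [MeasurableSpace α]
    [MeasurableSingletonClass α] [Fintype β] [MeasurableSpace β] [MeasurableSingletonClass β]
    {A : Ω → α} {B : Ω → β} (hA : Measurable A) (hB : Measurable B) (hAB : IndepFun A B ν)
    (g : α → β → ℝ) :
    ∫ ω, g (A ω) (B ω) ∂ν = ∫ ω, ∑ b, ν.real (B ⁻¹' {b}) * g (A ω) b ∂ν := by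
  have hg : Measurable (Function.uncurry g) := measurable_of_finite _
  calc ∫ ω, g (A ω) (B ω) ∂ν
      = ∫ ab, Function.uncurry g ab ∂(ν.map fun ω => (A ω, B ω)) :=
        (integral_map (hA.prodMk hB).aemeasurable hg.aestronglyMeasurable).symm
    _ = ∫ a, ∫ b, g a b ∂(ν.map B) ∂(ν.map A) := by
        rw [(indepFun_iff_map_prod_eq_prod_map_map hA.aemeasurable hB.aemeasurable).1 hAB,
          integral_prod _ Integrable.of_finite]
        rfl
    _ = ∫ a, ∑ b, ν.real (B ⁻¹' {b}) * g a b ∂(ν.map A) := by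
        simp only [integral_fintype Integrable.of_finite, smul_eq_mul,
          map_measureReal_apply hB (measurableSet_singleton _)]
    _ = ∫ ω, ∑ b, ν.real (B ⁻¹' {b}) * g (A ω) b ∂ν :=
        integral_map hA.aemeasurable (measurable_of_finite _).aestronglyMeasurable

/-- The blocks before the `k`-th, oldest first: the past on which the codeword of the `k`-th block
may depend. -/
def pastBlocks {α : Type} (q : ℕ) (x : ℕ → α) (k : ℕ) : List (Fin q → α) :=
  (List.range k).map (block q x)

lemma pastBlocks_eq_ofFn {α : Type} (q : ℕ) (x : ℕ → α) (k : ℕ) :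
    pastBlocks q x k = List.ofFn fun i : Fin k => block q x i := by
  rw [pastBlocks, List.ofFn_eq_map, ← List.map_coe_finRange_eq_range, List.map_map]
  rfl

namespace ShapingEncoder

variable {q : ℕ} {α β : Type}

lemma sum_map_output (φ : ShapingEncoder q α β) (f : β → ℝ) (x : ℕ → α) (t : ℕ) :
    ((φ.output x t).map f).sum =
      ∑ k ∈ Finset.range t, ((φ (pastBlocks q x k) (block q x k)).map f).sum := by
  unfold ShapingEncoder.output
  induction t with
  | zero => simp
  | succ t ih =>
    rw [List.range_succ, List.flatMap_append, List.map_append, List.sum_append, ih,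
      Finset.sum_range_succ]
    simp [pastBlocks]

/-- The expected cost of the codeword of a block of `q` independent letters with probabilities `p`,
after the past `h`; a codeword costs the sum of the costs `f` of its symbols. -/
noncomputable def expectedCost [Fintype α] (φ : ShapingEncoder q α β) (p : α → ℝ) (f : β → ℝ)
    (h : List (Fin q → α)) : ℝ :=
  ∑ b : Fin q → α, (∏ j, p (b j)) * ((φ h b).map f).sum

end ShapingEncoder

section Blocks

variable {Ω : Type*} [MeasurableSpace Ω] {ν : Measure Ω} {α : Type} [MeasurableSpace α]
  {X : ℕ → Ω → α}

lemma measurable_block (hX : ∀ n, Measurable (X n)) (q k : ℕ) :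
    Measurable fun ω => block q (fun n => X n ω) k :=
  measurable_pi_lambda _ fun _ => hX _

lemma measurable_blocks (hX : ∀ n, Measurable (X n)) (q k : ℕ) :
    Measurable fun ω => fun i : Fin k => block q (fun n => X n ω) i :=
  measurable_pi_lambda _ fun _ => measurable_block hX q _

lemma indepFun_blocks_block (hX : ∀ n, Measurable (X n)) (hX_indep : iIndepFun X ν) (q k : ℕ) :
    IndepFun (fun ω => fun i : Fin k => block q (fun n => X n ω) i)
      (fun ω => block q (fun n => X n ω) k) ν := by
  have hdisj : Disjoint (Finset.range (k * q)) (Finset.Ico (k * q) ((k + 1) * q)) := by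
    rw [Finset.range_eq_Ico]
    exact Finset.Ico_disjoint_Ico_consecutive 0 (k * q) ((k + 1) * q)
  have hlt (i : ℕ) (j : Fin q) : i * q + j < (i + 1) * q := by
    rw [add_one_mul]
    exact Nat.add_lt_add_left j.2 _
  have hpast (i : Fin k) (j : Fin q) : i * q + j ∈ Finset.range (k * q) :=
    Finset.mem_range.2 ((hlt i j).trans_le (Nat.mul_le_mul_right q i.2))
  have hblock (j : Fin q) : k * q + j ∈ Finset.Ico (k * q) ((k + 1) * q) :=
    Finset.mem_Ico.2 ⟨Nat.le_add_right _ _, hlt k j⟩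
  exact (hX_indep.indepFun_finset _ _ hdisj hX).comp
    (φ := fun v => fun (i : Fin k) (j : Fin q) => v ⟨i * q + j, hpast i j⟩)
    (ψ := fun v => fun j : Fin q => v ⟨k * q + j, hblock j⟩)
    (measurable_pi_lambda _ fun _ => measurable_pi_lambda _ fun _ => measurable_pi_apply _)
    (measurable_pi_lambda _ fun _ => measurable_pi_apply _)

variable [IsFiniteMeasure ν] [Finite α] [MeasurableSingletonClass α]

lemma integrable_pastBlocks_block (hX : ∀ n, Measurable (X n)) (q k : ℕ)
    (g : List (Fin q → α) → (Fin q → α) → ℝ) :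
    Integrable (fun ω => g (pastBlocks q (fun n => X n ω) k) (block q (fun n => X n ω) k)) ν := by
  simp only [pastBlocks_eq_ofFn]
  exact integrable_comp_of_finite ((measurable_blocks hX q k).prodMk (measurable_block hX q k))
    fun a => g (List.ofFn a.1) a.2

lemma integrable_pastBlocks (hX : ∀ n, Measurable (X n)) (q k : ℕ)
    (g : List (Fin q → α) → ℝ) :
    Integrable (fun ω => g (pastBlocks q (fun n => X n ω) k)) ν :=
  integrable_pastBlocks_block hX q k fun h _ => g h

lemma ShapingEncoder.integrable_sum_map_output {β : Type} {q : ℕ} (hX : ∀ n, Measurable (X n))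
    (φ : ShapingEncoder q α β) (f : β → ℝ) (t : ℕ) :
    Integrable (fun ω => ((φ.output (fun n => X n ω) t).map f).sum) ν := by
  simp only [φ.sum_map_output]
  exact integrable_finsetSum _ fun k _ =>
    integrable_pastBlocks_block hX q k fun h b => ((φ h b).map f).sum

lemma ShapingEncoder.HasAverageCost.linear_combination {β : Type} {q : ℕ}
    {φ : ShapingEncoder q α β} {f g : β → ℝ} {C D : ℝ} (hC : φ.HasAverageCost ν X f C)
    (hD : φ.HasAverageCost ν X g D) (hX : ∀ n, Measurable (X n)) (r s : ℝ) :
    φ.HasAverageCost ν X (fun a => r * f a + s * g a) (r * C + s * D) := by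
  refine ((hC.const_mul r).add (hD.const_mul s)).congr fun t => ?_
  simp only [List.sum_map_add, List.sum_map_mul_left, integral_div]
  rw [integral_add ((φ.integrable_sum_map_output hX f t).const_mul r)
    ((φ.integrable_sum_map_output hX g t).const_mul s), integral_const_mul, integral_const_mul]
  ring

end Blocks

lemma ShapingEncoder.hasExpansionFactor_iff {Ω : Type*} [MeasurableSpace Ω] {ν : Measure Ω}
    {q : ℕ} {α β : Type} {X : ℕ → Ω → α} {φ : ShapingEncoder q α β} {r : ℝ} :
    φ.HasExpansionFactor ν X r ↔ φ.HasAverageCost ν X (fun _ => 1) r := by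
  simp [ShapingEncoder.HasExpansionFactor, ShapingEncoder.HasAverageCost]

/-- The variables `X n` are independent and identically distributed letters, the letter `x` having
probability `p x`. -/
structure IsIIDSource {Ω α : Type*} [MeasurableSpace Ω] [MeasurableSpace α] (ν : Measure Ω)
    (X : ℕ → Ω → α) (p : α → ℝ) : Prop where
  measurable : ∀ n, Measurable (X n)
  indep : iIndepFun X ν
  identDistrib : ∀ n, IdentDistrib (X n) (X 0) ν ν
  prob : ∀ x, ν.real (X 0 ⁻¹' {x}) = p x

namespace IsIIDSource

variable {Ω : Type*} [MeasurableSpace Ω] {ν : Measure Ω} {α : Type} [MeasurableSpace α]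
  {X : ℕ → Ω → α} {p : α → ℝ}

lemma prob_nonneg (h : IsIIDSource ν X p) (x : α) : 0 ≤ p x := h.prob x ▸ measureReal_nonneg

variable [MeasurableSingletonClass α]

lemma measureReal_block (h : IsIIDSource ν X p) (q k : ℕ) (b : Fin q → α) :
    ν.real ((fun ω => block q (fun n => X n ω) k) ⁻¹' {b}) = ∏ j, p (b j) := by
  have hinj : Function.Injective fun j : Fin q => k * q + (j : ℕ) := fun _ _ hij =>
    Fin.ext (Nat.add_left_cancel hij)
  have hset : (fun ω => block q (fun n => X n ω) k) ⁻¹' {b} =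
      ⋂ j : Fin q, X (k * q + j) ⁻¹' {b j} := by
    ext ω
    simp [block, funext_iff]
  rw [measureReal_def, hset, (h.indep.precomp hinj).meas_iInter
    (s := fun j : Fin q => X (k * q + j) ⁻¹' {b j})
    fun j => ⟨{b j}, measurableSet_singleton _, rfl⟩, ENNReal.toReal_prod]
  refine Finset.prod_congr rfl fun j _ => ?_
  rw [(h.identDistrib _).measure_mem_eq (measurableSet_singleton _), ← measureReal_def, h.prob]

variable [IsProbabilityMeasure ν] [Fintype α]

lemma sum_prob (h : IsIIDSource ν X p) : ∑ x, p x = 1 := by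
  simp only [← h.prob]
  rw [sum_measureReal_preimage_singleton _ fun x _ => h.measurable 0 (measurableSet_singleton x)]
  simp

lemma integral_pastBlocks_block (h : IsIIDSource ν X p) (q k : ℕ)
    (g : List (Fin q → α) → (Fin q → α) → ℝ) :
    ∫ ω, g (pastBlocks q (fun n => X n ω) k) (block q (fun n => X n ω) k) ∂ν =
      ∫ ω, ∑ b : Fin q → α, (∏ j, p (b j)) * g (pastBlocks q (fun n => X n ω) k) b ∂ν := by
  simp only [pastBlocks_eq_ofFn]
  rw [integral_comp_eq_integral_sum_of_indepFun (measurable_blocks h.measurable q k)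
    (measurable_block h.measurable q k) (indepFun_blocks_block h.measurable h.indep q k)
    fun a b => g (List.ofFn a) b]
  simp only [h.measureReal_block]

lemma integral_sum_map_output_div (h : IsIIDSource ν X p) {β : Type} {q : ℕ}
    (φ : ShapingEncoder q α β) (f : β → ℝ) (t : ℕ) :
    ∫ ω, ((φ.output (fun n => X n ω) t).map f).sum / ((t : ℝ) * (q : ℝ)) ∂ν =
      (∑ k ∈ Finset.range t, ∫ ω, φ.expectedCost p f (pastBlocks q (fun n => X n ω) k) ∂ν) /
        ((t : ℝ) * (q : ℝ)) := by
  rw [integral_div]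
  simp only [φ.sum_map_output]
  rw [integral_finsetSum _ fun k _ => integrable_pastBlocks_block h.measurable q k
    fun l b => ((φ l b).map f).sum]
  simp only [h.integral_pastBlocks_block q _ fun l b => ((φ l b).map f).sum,
    ShapingEncoder.expectedCost]

lemma hasAverageCost_of_ae_tendsto (h : IsIIDSource ν X p) {β : Type} {q : ℕ} (hq : 0 < q)
    {φ : ShapingEncoder q α β} {f : β → ℝ} {C M : ℝ} (hM : ∀ l, |φ.expectedCost p f l| ≤ M)
    (hC : ∀ᵐ ω ∂ν, Tendsto (fun k => φ.expectedCost p f (pastBlocks q (fun n => X n ω) k)) atTop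
      (𝓝 (q * C))) :
    φ.HasAverageCost ν X f C := by
  have hint : Tendsto
      (fun k => ∫ ω, φ.expectedCost p f (pastBlocks q (fun n => X n ω) k) ∂ν) atTop
      (𝓝 (∫ _, q * C ∂ν)) :=
    tendsto_integral_of_dominated_convergence (fun _ => M)
      (fun k => (integrable_pastBlocks h.measurable q k _).aestronglyMeasurable)
      (integrable_const _) (fun k => Eventually.of_forall fun ω => hM _) hC
  rw [integral_const, probReal_univ, one_smul] at hint
  have hmean := hint.cesaro.div_const (q : ℝ)
  rw [mul_div_cancel_left₀ C (by positivity)] at hmean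
  refine hmean.congr fun t => ?_
  rw [h.integral_sum_map_output_div, ← div_div, div_eq_inv_mul _ (t : ℝ)]

lemma hasAverageCost_of_forall_eq (h : IsIIDSource ν X p) {β : Type} {q : ℕ} (hq : 0 < q)
    {φ : ShapingEncoder q α β} {f : β → ℝ} {C : ℝ} (hC : ∀ l, φ.expectedCost p f l = q * C) :
    φ.HasAverageCost ν X f C :=
  h.hasAverageCost_of_ae_tendsto hq (fun l => (congrArg abs (hC l)).le)
    (Eventually.of_forall fun _ => by simp only [hC, tendsto_const_nhds_iff])

lemma le_of_hasAverageCost (h : IsIIDSource ν X p) {β : Type} {q : ℕ} (hq : 0 < q)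
    {φ : ShapingEncoder q α β} {f : β → ℝ} {C E : ℝ} (hφ : φ.HasAverageCost ν X f C)
    (hE : ∀ l, q * E ≤ φ.expectedCost p f l) : E ≤ C := by
  refine ge_of_tendsto hφ ?_
  filter_upwards [eventually_gt_atTop 0] with t ht
  have hint (k : ℕ) : q * E ≤ ∫ ω, φ.expectedCost p f (pastBlocks q (fun n => X n ω) k) ∂ν := by
    simpa using integral_mono (μ := ν) (integrable_const (q * E))
      (integrable_pastBlocks h.measurable q k (φ.expectedCost p f)) fun ω => hE _
  rw [h.integral_sum_map_output_div, le_div_iff₀ (by positivity)]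
  calc E * (t * q) = ∑ _k ∈ Finset.range t, q * E := by simp; ring
    _ ≤ _ := Finset.sum_le_sum fun k _ => hint k

end IsIIDSource

/-! ### The cost of rate-1 codes on a Gibbs source -/

lemma ShapingEncoder.PrefixFree.entropy_le_expectedCost {q : ℕ} {α β : Type} [Fintype α]
    [Fintype β] {φ : ShapingEncoder q α β} (hφ : φ.PrefixFree) {p : α → ℝ} (hp : ∀ x, 0 ≤ p x)
    (hp_sum : ∑ x, p x = 1) {f : β → ℝ} (hf : ∑ a, Real.exp (-f a) ≤ 1)
    (l : List (Fin q → α)) :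
    q * ∑ x, Real.negMulLog (p x) ≤ φ.expectedCost p f l := by
  have hexp (s : List β) : (s.map fun a => Real.exp (-f a)).prod = Real.exp (-(s.map f).sum) := by
    induction s with
    | nil => simp
    | cons a s ih => simp [ih, Real.exp_add, add_comm]
  have hkraft := sum_prod_map_le_one_of_prefixFree (fun a => (Real.exp_pos (-f a)).le) hf
    Finset.univ (φ l) fun b _ b' _ => hφ l b b'
  have hprod : ∑ b : Fin q → α, ∏ j, p (b j) = 1 := by
    rw [← Fintype.prod_sum fun _ x => p x]
    simp [hp_sum]
  calc q * ∑ x, Real.negMulLog (p x) = ∑ b : Fin q → α, Real.negMulLog (∏ j, p (b j)) := by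
        rw [sum_negMulLog_prod hp_sum, Fintype.card_fin]
    _ ≤ φ.expectedCost p f l :=
        sum_negMulLog_le_sum_mul (fun b _ => Finset.prod_nonneg fun j _ => hp (b j))
          (by simpa only [hexp, hprod] using hkraft)

namespace IsIIDSource

variable {Ω : Type*} [MeasurableSpace Ω] {ν : Measure Ω} [IsProbabilityMeasure ν] {α β : Type}
  [MeasurableSpace α] [MeasurableSingletonClass α] [Fintype α] [Fintype β] [Nonempty β]
  {X : ℕ → Ω → α} {p : α → ℝ} {q : ℕ} {cost : β → ℝ} {C : ℝ} {ψ : ShapingEncoder q α β}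

/-- This is the entropy bound for the modified costs `s * cost a + log Z(s)`, which satisfy Kraft's
inequality with equality; at rate 1 they average to `s * C + log Z(s)`. -/
lemma entropy_le_of_isRateOne (h : IsIIDSource ν X p) (hψ : ψ.IsRateOne ν X)
    (hC : ψ.HasAverageCost ν X cost C) (s : ℝ) :
    ∑ x, Real.negMulLog (p x) ≤ s * C + Real.log (partitionFunction cost s) := by
  obtain ⟨hq, hfree, hone⟩ := hψ
  have hZ := partitionFunction_pos cost s
  have hkraft : ∑ a, Real.exp (-(s * cost a + Real.log (partitionFunction cost s) * 1)) ≤ 1 := by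
    refine le_of_eq ((Finset.sum_congr rfl fun a _ => ?_).trans (sum_gibbsProb cost s))
    rw [mul_one, neg_add, ← sub_eq_add_neg, Real.exp_sub, Real.exp_log hZ, gibbsProb]
  have hcost := hC.linear_combination (ShapingEncoder.hasExpansionFactor_iff.1 hone)
    h.measurable s (Real.log (partitionFunction cost s))
  refine (h.le_of_hasAverageCost hq hcost fun l => ?_).trans_eq (by rw [mul_one])
  exact hfree.entropy_le_expectedCost h.prob_nonneg h.sum_prob hkraft l

lemma sum_mul_le_of_isRateOne_of_eq_gibbsProb (h : IsIIDSource ν X p) (e : α ≃ β) {r : ℝ}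
    (hr : 0 ≤ r) (hp : ∀ x, p x = gibbsProb cost r (e x)) (hψ : ψ.IsRateOne ν X)
    (hC : ψ.HasAverageCost ν X cost C) : ∑ x, p x * cost (e x) ≤ C := by
  have hbound := h.entropy_le_of_isRateOne hψ hC
  simp only [hp] at hbound ⊢
  rw [e.sum_comp fun a => gibbsProb cost r a * cost a]
  refine sum_gibbsProb_mul_le_of_forall_entropy_le cost hr fun s => ?_
  rw [← e.sum_comp]
  exact hbound s

end IsIIDSource

/-! ### Exchanging the codewords of two blocks -/

lemma sum_mul_comp_swap {ι R : Type*} [Fintype ι] [DecidableEq ι] [CommRing R] (p F : ι → R)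
    (I J : ι) :
    ∑ b, p b * F (Equiv.swap I J b) = ∑ b, p b * F b + (p I - p J) * (F J - F I) := by
  obtain rfl | hIJ := eq_or_ne I J
  · simp
  · rw [← sub_eq_iff_eq_add', ← Finset.sum_sub_distrib, Fintype.sum_eq_add I J hIJ]
    · rw [Equiv.swap_apply_left, Equiv.swap_apply_right]; ring
    · rintro b ⟨hI, hJ⟩
      rw [Equiv.swap_apply_of_ne_of_ne hI hJ, sub_self]

/-- The block code that first permutes the blocks of `q` letters by `σ` and then encodes letter by
letter by `e`. -/
def permutedLetterCode {q : ℕ} {α β : Type} (e : α → β) (σ : Equiv.Perm (Fin q → α)) :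
    ShapingEncoder q α β := fun _ b => List.ofFn fun j => e (σ b j)

lemma permutedLetterCode_prefixFree {q : ℕ} {α β : Type} {e : α → β} (he : Function.Injective e)
    (σ : Equiv.Perm (Fin q → α)) : (permutedLetterCode e σ).PrefixFree := by
  intro _ b b' hbb
  have hword := List.ofFn_injective (hbb.eq_of_length (by simp [permutedLetterCode]))
  exact σ.injective (funext fun j => he (congrFun hword j))

lemma expectedCost_permutedLetterCode {q : ℕ} {α β : Type} [Fintype α] (e : α → β)
    (σ : Equiv.Perm (Fin q → α)) (p : α → ℝ) (f : β → ℝ) (l : List (Fin q → α)) :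
    (permutedLetterCode e σ).expectedCost p f l =
      ∑ b : Fin q → α, (∏ j, p (b j)) * ∑ j, f (e (σ b j)) := by
  simp [ShapingEncoder.expectedCost, permutedLetterCode, List.map_ofFn, List.sum_ofFn]

namespace IsIIDSource

variable {Ω : Type*} [MeasurableSpace Ω] {ν : Measure Ω} [IsProbabilityMeasure ν] {α β : Type}
  [MeasurableSpace α] [MeasurableSingletonClass α] {X : ℕ → Ω → α} {p : α → ℝ} {e : α → β}

lemma permutedLetterCode_isRateOne [Finite α] (h : IsIIDSource ν X p) (he : Function.Injective e)
    {q : ℕ} (hq : 0 < q) (σ : Equiv.Perm (Fin q → α)) :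
    (permutedLetterCode e σ).IsRateOne ν X := by
  have := Fintype.ofFinite α
  refine ⟨hq, permutedLetterCode_prefixFree he σ, ShapingEncoder.hasExpansionFactor_iff.2
    (h.hasAverageCost_of_forall_eq hq fun l => ?_)⟩
  rw [expectedCost_permutedLetterCode]
  simpa [h.sum_prob] using sum_prod_mul_sum (ι := Fin q) h.sum_prob fun _ => 1

lemma isCostOrdered_of_forall_le [Fintype α] (h : IsIIDSource ν X p)
    (he : Function.Injective e) {cost : β → ℝ}
    (hopt : ∀ (q : ℕ) (ψ : ShapingEncoder q α β) (C : ℝ), ψ.IsRateOne ν X →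
      ψ.HasAverageCost ν X cost C → ∑ x, p x * cost (e x) ≤ C) :
    IsCostOrdered p (cost ∘ e) := by
  classical
  intro q I J hIJ
  obtain rfl | hq := q.eq_zero_or_pos
  · simp
  set F : (Fin q → α) → ℝ := fun b => ∑ j, cost (e (b j))
  have hswap := hopt q _ _ (h.permutedLetterCode_isRateOne he hq (Equiv.swap I J))
    (h.hasAverageCost_of_forall_eq hq
      (C := (∑ b : Fin q → α, (∏ j, p (b j)) * F (Equiv.swap I J b)) / q) fun l => by
        rw [expectedCost_permutedLetterCode, mul_div_cancel₀ _ (by positivity)])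
  have hletter : ∑ b : Fin q → α, (∏ j, p (b j)) * F b = q * ∑ x, p x * cost (e x) := by
    simpa using sum_prod_mul_sum (ι := Fin q) h.sum_prob fun x => cost (e x)
  rw [le_div_iff₀ (by positivity), mul_comm, ← hletter,
    sum_mul_comp_swap (fun b : Fin q → α => ∏ j, p (b j)), le_add_iff_nonneg_right] at hswap
  exact sub_nonneg.1 (nonneg_of_mul_nonneg_right hswap (sub_pos.2 hIJ))

end IsIIDSource

/-! ### The cost of the direct shaping code -/

lemma exists_expectedCost_directShapingCode_eq {m : ℕ} (y : Fin (2 ^ m) → Word m)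
    (l : List (Fin 1 → Word m)) :
    ∃ d : Fin (2 ^ m) ≃ Word m, Antitone (wordCount l ∘ d) ∧ ∀ p f : Word m → ℝ,
      (directShapingCode y).expectedCost p f l = ∑ k, p (d k) * f (y k) := by
  obtain ⟨d, hd, hcode⟩ := exists_directShapingCode_eq y l
  refine ⟨d, hd, fun p f => ?_⟩
  rw [ShapingEncoder.expectedCost, ← (d.trans (Equiv.funUnique (Fin 1) (Word m)).symm).sum_comp]
  simp [hcode]

lemma abs_expectedCost_directShapingCode_le {m : ℕ} (y : Fin (2 ^ m) → Word m)
    {p : Word m → ℝ} (hp : ∀ x, |p x| ≤ 1) (f : Word m → ℝ) (l : List (Fin 1 → Word m)) :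
    |(directShapingCode y).expectedCost p f l| ≤ ∑ k, |f (y k)| := by
  obtain ⟨d, -, hd⟩ := exists_expectedCost_directShapingCode_eq y l
  rw [hd]
  refine (Finset.abs_sum_le_sum_abs _ _).trans (Finset.sum_le_sum fun k _ => ?_)
  rw [abs_mul]
  exact mul_le_of_le_one_left (abs_nonneg _) (hp _)

lemma expectedCost_directShapingCode_eq_of_wordCount_lt {m : ℕ} (y : Fin (2 ^ m) → Word m)
    {p : Word m → ℝ} {w : Fin (2 ^ m) ≃ Word m} (hw : Antitone (p ∘ w)) (f : Word m → ℝ)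
    {l : List (Fin 1 → Word m)} (hl : ∀ u v, p u < p v → wordCount l u < wordCount l v) :
    (directShapingCode y).expectedCost p f l = ∑ i, p (w i) * f (y i) := by
  obtain ⟨d, hd, hcost⟩ := exists_expectedCost_directShapingCode_eq y l
  have hpd : Antitone (p ∘ d) := fun i j hij =>
    not_lt.1 fun hlt => (hl _ _ hlt).not_ge (hd hij)
  have hsort : p ∘ d = p ∘ w := by
    have hperm : (p ∘ w) ∘ (d.trans w.symm) = p ∘ d := by ext; simp
    have := Tuple.unique_antitone (f := p ∘ w) (σ := d.trans w.symm) (τ := Equiv.refl _)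
      (by rwa [hperm]) hw
    rwa [hperm] at this
  rw [hcost]
  exact Finset.sum_congr rfl fun k _ => congrArg (· * f (y k)) (congrFun hsort k)

lemma wordCount_pastBlocks {m : ℕ} (x : ℕ → Word m) (v : Word m) (k : ℕ) :
    (wordCount (pastBlocks 1 x k) v : ℝ) =
      ∑ i ∈ Finset.range k, ({v} : Set (Word m)).indicator 1 (x i) := by
  induction k with
  | zero => simp [pastBlocks, wordCount]
  | succ k ih =>
    rw [Finset.sum_range_succ, ← ih]
    obtain rfl | hv := eq_or_ne (x k) v
    · simp [pastBlocks, wordCount, List.range_succ, block]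
    · simp [pastBlocks, wordCount, List.range_succ, block, hv]

namespace IsIIDSource

variable {Ω : Type*} [MeasurableSpace Ω] {ν : Measure Ω} [IsProbabilityMeasure ν] {m : ℕ}
  {X : ℕ → Ω → Word m} {p : Word m → ℝ}

lemma ae_tendsto_wordCount_div (h : IsIIDSource ν X p) (v : Word m) :
    ∀ᵐ ω ∂ν, Tendsto (fun k : ℕ => (wordCount (pastBlocks 1 (fun n => X n ω) k) v : ℝ) / k) atTop
      (𝓝 (p v)) := by
  set f : Word m → ℝ := ({v} : Set (Word m)).indicator 1
  have hf : Measurable f := measurable_of_finite _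
  have hmean : ∫ ω, f (X 0 ω) ∂ν = p v := by
    rw [← h.prob, ← integral_indicator_one (h.measurable 0 (measurableSet_singleton v))]
    rfl
  filter_upwards [strong_law_ae_real (fun n ω => f (X n ω))
    (integrable_comp_of_finite (h.measurable 0) f)
    (fun i j hij => (h.indep.indepFun hij).comp hf hf)
    fun n => (h.identDistrib n).comp hf] with ω hω
  simpa only [wordCount_pastBlocks, hmean] using hω

lemma ae_eventually_wordCount_lt (h : IsIIDSource ν X p) :
    ∀ᵐ ω ∂ν, ∀ᶠ k in atTop, ∀ u v, p u < p v →
      wordCount (pastBlocks 1 (fun n => X n ω) k) u <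
        wordCount (pastBlocks 1 (fun n => X n ω) k) v := by
  filter_upwards [ae_all_iff.2 h.ae_tendsto_wordCount_div] with ω hω
  refine eventually_all.2 fun u => eventually_all.2 fun v =>
    eventually_imp_distrib_left.2 fun huv => ?_
  filter_upwards [(hω u).eventually_lt (hω v) huv, eventually_gt_atTop 0] with k hk hk0
  rw [div_lt_div_iff_of_pos_right (by positivity)] at hk
  exact_mod_cast hk

lemma directShapingCode_hasAverageCost (h : IsIIDSource ν X p) {w : Fin (2 ^ m) ≃ Word m}
    (hw : Antitone (p ∘ w)) (y : Fin (2 ^ m) → Word m) (cost : Word m → ℝ) :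
    (directShapingCode y).HasAverageCost ν X cost (∑ i, p (w i) * cost (y i)) := by
  refine h.hasAverageCost_of_ae_tendsto one_pos
    (abs_expectedCost_directShapingCode_le y (fun x => ?_) cost) ?_
  · rw [abs_of_nonneg (h.prob_nonneg x), ← h.prob]
    exact measureReal_le_one
  · rw [Nat.cast_one, one_mul]
    filter_upwards [h.ae_eventually_wordCount_lt] with ω hω
    refine tendsto_const_nhds.congr' ?_
    filter_upwards [hω] with k hk
    exact (expectedCost_directShapingCode_eq_of_wordCount_lt y hw cost hk).symm

lemma directShapingCode_isRateOne (h : IsIIDSource ν X p) {y : Fin (2 ^ m) → Word m}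
    (hy : Function.Injective y) : (directShapingCode y).IsRateOne ν X := by
  refine ⟨one_pos, directShapingCode_prefixFree hy, ShapingEncoder.hasExpansionFactor_iff.2
    (h.hasAverageCost_of_forall_eq one_pos fun l => ?_)⟩
  obtain ⟨d, -, hd⟩ := exists_expectedCost_directShapingCode_eq y l
  simp only [hd, mul_one, Nat.cast_one]
  rw [d.sum_comp p, h.sum_prob]

lemma directShapingCode_isOptimalRateOne_iff (h : IsIIDSource ν X p) {w y : Fin (2 ^ m) ≃ Word m}
    (hw : Antitone (p ∘ w)) {cost : Word m → ℝ} {v₀ : Word m}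
    (hv₀ : ∀ v ≠ v₀, cost v₀ < cost v) (hp : entropyBits p ≠ 0) :
    (directShapingCode y).IsOptimalRateOne ν X cost ↔
      ∃ r, 0 ≤ r ∧ ∀ i, p (w i) = gibbsProb (cost ∘ y) r i := by
  set e : Word m ≃ Word m := w.symm.trans y with he
  have hdirect := h.directShapingCode_hasAverageCost hw y cost
  have hsum : ∑ i, p (w i) * cost (y i) = ∑ x, p x * cost (e x) := by
    rw [← w.sum_comp]
    simp [he]
  have hgibbs (r : ℝ) (i : Fin (2 ^ m)) :
      gibbsProb (cost ∘ y) r i = gibbsProb cost r (e (w i)) := by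
    simp [he, gibbsProb_comp_equiv]
  simp only [hgibbs]
  constructor
  · rintro ⟨-, C, hC, hopt⟩
    obtain rfl := tendsto_nhds_unique hC hdirect
    obtain ⟨i₁, hi₁, hpi₁⟩ := exists_ne_of_entropyBits_ne_zero h.sum_prob hp (e.symm v₀)
    have hmin : ∀ x ≠ e.symm v₀, (cost ∘ e) (e.symm v₀) < (cost ∘ e) x := fun x hx => by
      simpa using hv₀ (e x) fun hex => hx (e.symm_apply_eq.2 hex.symm).symm
    obtain ⟨r, hr, hpr⟩ := (h.isCostOrdered_of_forall_le e.injective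
      (by rwa [hsum] at hopt)).exists_eq_gibbsProb hmin h.prob_nonneg h.sum_prob hi₁ hpi₁
    exact ⟨r, hr, fun i => (hpr _).trans (gibbsProb_comp_equiv e cost r _)⟩
  · rintro ⟨r, hr, hpr⟩
    refine ⟨h.directShapingCode_isRateOne y.injective, _, hdirect, fun q ψ C hψ hC => ?_⟩
    rw [hsum]
    exact h.sum_mul_le_of_isRateOne_of_eq_gibbsProb e hr (w.surjective.forall.2 hpr) hψ hC

end IsIIDSource

lemma slcCost_lt_of_ne {m : ℕ} (v : Word m) (hv : v ≠ fun _ => true) :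
    slcCost (fun _ => true : Word m) < slcCost v := by
  obtain ⟨j, hj⟩ := Function.ne_iff.1 hv
  simpa [slcCost] using Finset.card_pos.2 ⟨j, by simpa using hj⟩

theorem mainTheorem6_general {Ω : Type*} [MeasurableSpace Ω] (ν : Measure Ω)
    [IsProbabilityMeasure ν] (m : ℕ) (X : ℕ → Ω → Word m) (hX_meas : ∀ n, Measurable (X n))
    (hX_indep : iIndepFun X ν) (hX_ident : ∀ n, IdentDistrib (X n) (X 0) ν ν)
    (w : Fin (2 ^ m) ≃ Word m) (P : Fin (2 ^ m) → ℝ) (hP : ∀ i, P i = ν.real (X 0 ⁻¹' {w i}))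
    (hP_anti : Antitone P) (y : Fin (2 ^ m) ≃ Word m) (cost : Word m → ℝ) (v₀ : Word m)
    (hv₀ : ∀ v ≠ v₀, cost v₀ < cost v) (hP_entropy : entropyBits P ≠ 0) :
    (directShapingCode y).IsOptimalRateOne ν X cost ↔
      ∃ μ : ℝ, 0 ≤ μ ∧
        ∀ i, P i = (2 : ℝ) ^ (-μ * cost (y i)) / ∑ j, (2 : ℝ) ^ (-μ * cost (y j)) := by
  have hsource : IsIIDSource ν X fun x => ν.real (X 0 ⁻¹' {x}) :=
    ⟨hX_meas, hX_indep, hX_ident, fun _ => rfl⟩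
  have hPw : P = (fun x => ν.real (X 0 ⁻¹' {x})) ∘ w := funext hP
  have hentropy : entropyBits P = entropyBits fun x => ν.real (X 0 ⁻¹' {x}) := by
    rw [hPw]
    exact congrArg Neg.neg
      (w.sum_comp fun x => ν.real (X 0 ⁻¹' {x}) * Real.logb 2 (ν.real (X 0 ⁻¹' {x})))
  have hlog : 0 < Real.log 2 := Real.log_pos one_lt_two
  rw [hsource.directShapingCode_isOptimalRateOne_iff (hPw ▸ hP_anti) hv₀ (hentropy ▸ hP_entropy)]
  simp only [hP]
  constructor
  · rintro ⟨r, hr, hPr⟩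
    refine ⟨r / Real.log 2, div_nonneg hr hlog.le, fun i => ?_⟩
    have hbase := two_rpow_div_sum_eq_gibbsProb (cost ∘ y) (r / Real.log 2) i
    rw [mul_div_cancel₀ r hlog.ne'] at hbase
    exact (hPr i).trans hbase.symm
  · rintro ⟨μ, hμ, hPμ⟩
    exact ⟨Real.log 2 * μ, mul_nonneg hlog.le hμ, fun i =>
      (hPμ i).trans (two_rpow_div_sum_eq_gibbsProb (cost ∘ y) μ i)⟩

theorem mainTheorem6 {Ω : Type*} [MeasurableSpace Ω] (ν : Measure Ω) [IsProbabilityMeasure ν]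
    (m : ℕ)
    -- the i.i.d. source of words of length `m`
    (X : ℕ → Ω → Word m) (hX_meas : ∀ n, Measurable (X n)) (hX_indep : iIndepFun X ν)
    (hX_ident : ∀ n, IdentDistrib (X n) (X 0) ν ν)
    -- the input words `w i` by non-increasing probability `P i`
    (w : Fin (2 ^ m) ≃ Word m) (P : Fin (2 ^ m) → ℝ)
    (hP : ∀ i, P i = ν.real (X 0 ⁻¹' {w i})) (hP_anti : Antitone P)
    -- the output list `y i` by non-decreasing cost `c i`
    (y : Fin (2 ^ m) ≃ Word m) (c : Fin (2 ^ m) → ℝ)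
    (hc : ∀ i, c i = slcCost (y i)) (hc_mono : Monotone c)
    (H : ℝ) (hH : entropyBits P = H) (hH_pos : 0 < H) :
    (directShapingCode y).IsOptimalRateOne ν X slcCost ↔
      ∃ μ : ℝ, 0 ≤ μ ∧
        (∀ i, P i = (2 : ℝ) ^ (-μ * c i) / ∑ j, (2 : ℝ) ^ (-μ * c j)) ∧
        entropyBits P = H := by
  subst hH
  obtain rfl : c = slcCost ∘ y := funext hc
  simp only [and_true]
  exact mainTheorem6_general ν m X hX_meas hX_indep hX_ident w P hP hP_anti y slcCost _
    slcCost_lt_of_ne hH_pos.ne'
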